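/- For a measurable function $f:[0,\pi]\to\mathbb{R}$, $\alpha\in\mathbb{R}$, an integer $k\ge 0$ and $1\le p<\infty$ put \[ \Lambda(\alpha,p,k,f)=\inf_{J,\,P}\ |J|^{-\alpha}\Bigl(\frac1{|J|}\int_J |f(x)-P(x)|^p\,dx\Bigr)^{1/p}\in[0,\infty], \] where the infimum runs over all intervals $J\subset[0,\pi]$ with $0<|J|\le 1$ and all real polynomials $P$ of degree at most $k$. Let $X=(X_t)_{t\in[0,\pi]}$ be a real-valued Gaussian process on a probability space $(\Omega,\mathcal{A},\mathbb{P})$, not necessarily centred, such that $(t,\omega)\mapsto X_t(\omega)$ is measurable (possibly after modification on a null set for the product of Lebesgue measure and $\mathbb{P}$). Let $H>1$, and suppose that $X$ is $H$-strongly locally nondeterministic: there is $c>0$ such that for all $0\le s\le t\le\pi$, almost surely, \[ \operatorname{Var}\bigl(X_t\mid\sigma(X_r:0\le r\le s)\bigr)\ \ge\ c\,|t-s|^{2H}. \] Then for every $\alpha>H$, every real $p$ with $1\le p<\infty$ and every integer $k\ge1$, \[ \mathbb{P}\bigl(\Lambda(\alpha,p,k,X)>0\bigr)=1 . \] -/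

import Mathlib

open MeasureTheory ProbabilityTheory
open scoped ENNReal

/-- Lebesgue measure on the interval `[l, r]`, as a measure on the subtype. -/
noncomputable abbrev lebesgueOn (l r : ℝ) : Measure (Set.Icc l r) :=
  Measure.comap Subtype.val (volume : Measure ℝ)

/-- Wei's irregularity index of a function `f : [l, r] → ℝ`: the infimum of
`|J|^(-α) * (⨍_J |f - P|^p)^(1/p)` over all intervals `J = [a, b] ⊆ [l, r]` with
`0 < |J| ≤ 1` and all real polynomials `P` of degree at most `k`.
It takes values in `[0, ∞]`; the averages are Lebesgue averages (`⨍⁻`), so the index makes sense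
for every measurable `f`, and it is the usual real number when `f ∈ L^p`. -/
noncomputable def irregularityIndex {l r : ℝ} (α : ℝ) (k : ℕ) (p : ℝ)
    (f : Set.Icc l r → ℝ) : ℝ≥0∞ :=
  ⨅ (a : Set.Icc l r) (b : Set.Icc l r) (_ : (a : ℝ) < b) (_ : (b : ℝ) - a ≤ 1)
    (P : Polynomial ℝ) (_ : P.natDegree ≤ k),
    ENNReal.ofReal (((b : ℝ) - a) ^ (-α)) *
      (⨍⁻ x in Set.Icc a b, ‖f x - P.eval (x : ℝ)‖ₑ ^ p ∂(lebesgueOn l r)) ^ (1 / p)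

/-- The σ-algebra `σ(X_r : 0 ≤ r ≤ s)` generated by a process up to time `s`. -/
abbrev pastSigmaAlgebra {Ω : Type*} {T : ℝ} (X : Set.Icc (0 : ℝ) T → Ω → ℝ)
    (s : Set.Icc (0 : ℝ) T) : MeasurableSpace Ω :=
  ⨆ r ≤ s, MeasurableSpace.comap (X r) inferInstance

/-- `H`-strong local nondeterminism on `[0, T]`: there is `c > 0` such that, for all
`0 ≤ s ≤ t ≤ T`, `Var(X_t | σ(X_r : r ≤ s)) ≥ c |t - s|^(2H)` almost surely. -/
def IsStronglyLocallyNondeterministic {Ω : Type*} [MeasurableSpace Ω] {T : ℝ}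
    (X : Set.Icc (0 : ℝ) T → Ω → ℝ) (H : ℝ) (μ : Measure Ω) : Prop :=
  ∃ c : ℝ, 0 < c ∧ ∀ s t : Set.Icc (0 : ℝ) T, s ≤ t →
    ∀ᵐ ω ∂μ, c * |(t : ℝ) - s| ^ (2 * H) ≤ (Var[X t; μ | pastSigmaAlgebra X s]) ω

/-!
The `(k + 1)`-st difference of step `d` annihilates polynomials of degree at most `k`. Hence, if `f`
is within `δ |J| ^ α` of such a polynomial in `L^p`-average on an interval `J`, then on a dyadic
interval `I ⊆ J` of comparable length `η` and for at least half of the shifts `u ∈ [0, d]`, where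
`d = η / M` for a fixed number `M` of grid points, all `(k + 1)`-st differences of `f` along the
grid with origin shifted by `u` are `O(δ η ^ α)` (`exists_dyadic_ofReal_le_volume`: Markov's
inequality and a union bound over the grid).

For the Gaussian process, the last variable in such a difference is, given the earlier ones, a
shifted Gaussian of variance at least `c d ^ (2H)`: it splits into its linear regression on the
earlier ones and an independent Gaussian residual, and the residual variance is at least the mean
conditional variance given the whole past. So each further difference being `O(δ η ^ α)` costs a
factor `O(δ η ^ (α - H))`, and `N` of them cost its `N`-th power (`measure_forall_abs_sum_le`).
Fubini's theorem averages this over the shifts `u`, which makes the estimate insensitive to changing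
the process on a null set of the product (`measure_ofReal_le_volume_le`).

There are about `η⁻¹` dyadic intervals of length `η`. Choosing `N` with `(α - H) N ≥ 2`, the sum of
the bounds over all dyadic intervals is `O(δ)`, so the index is below `δ` with probability `O(δ)`
(`exists_measure_irregularityIndex_lt_le`), and it vanishes with probability zero.
-/

/-! ### Linear prediction in Gaussian processes -/

/-- Orthogonal projection in `L²`: a square-integrable variable minus a suitable linear combination
of finitely many others is uncorrelated with each of them. -/
lemma exists_covariance_sub_sum_eq_zero {Ω ι : Type*} [MeasurableSpace Ω] {μ : Measure Ω}
    [IsProbabilityMeasure μ] [Fintype ι] {X : ι → Ω → ℝ} {Y : Ω → ℝ}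
    (hX : ∀ i, MemLp (X i) 2 μ) (hY : MemLp Y 2 μ) :
    ∃ w : ι → ℝ, ∀ i, cov[fun ω => Y ω - ∑ j, w j * X j ω, X i; μ] = 0 := by
  have hc : ∀ {Z : Ω → ℝ}, MemLp Z 2 μ → MemLp (fun ω => Z ω - μ[Z]) 2 μ := fun hZ =>
    hZ.sub (memLp_const _)
  let x : ι → Lp ℝ 2 μ := fun i => (hc (hX i)).toLp
  let y : Lp ℝ 2 μ := (hc hY).toLp
  let S := Submodule.span ℝ (Set.range x)
  have : FiniteDimensional ℝ S := FiniteDimensional.span_of_finite ℝ (Set.finite_range x)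
  obtain ⟨w, hw⟩ := (Submodule.mem_span_range_iff_exists_fun ℝ).1 (S.starProjection_apply_mem y)
  refine ⟨w, fun i => ?_⟩
  have horth : inner ℝ (y - ∑ j, w j • x j) (x i) = 0 := by
    rw [hw]
    exact S.starProjection_inner_eq_zero y (x i) (Submodule.subset_span ⟨i, rfl⟩)
  rw [inner_sub_left, sum_inner] at horth
  simp only [inner_smul_left] at horth
  have key : ∀ {U V : Ω → ℝ} (hU : MemLp U 2 μ) (hV : MemLp V 2 μ),
      inner ℝ (hc hU).toLp (hc hV).toLp = cov[U, V; μ] := by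
    intro U V hU hV
    rw [covariance, L2.inner_def]
    refine integral_congr_ae ?_
    filter_upwards [(hc hU).coeFn_toLp, (hc hV).coeFn_toLp] with a h1 h2
    rw [h1, h2]
    simp [mul_comm]
  have h1 : cov[fun ω => Y ω - ∑ j, w j * X j ω, X i; μ]
      = cov[Y, X i; μ] - ∑ j, w j * cov[X j, X i; μ] := by
    rw [covariance_fun_sub_left hY (memLp_finsetSum _ fun j _ => (hX j).const_mul _) (hX i),
      covariance_fun_sum_left (fun j => (hX j).const_mul _) (hX i)]
    simp [covariance_const_mul_left]
  rw [h1]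
  have hy : inner ℝ y (x i) = cov[Y, X i; μ] := key hY (hX i)
  have hx : ∀ j, inner ℝ (x j) (x i) = cov[X j, X i; μ] := fun j => key (hX j) (hX i)
  simpa only [hy, hx, RCLike.conj_to_real] using horth

/-- In a Gaussian process, a variable minus its linear regression on finitely many others is
independent of those. -/
lemma ProbabilityTheory.IsGaussianProcess.exists_indepFun_sub_sum {Ω ι T : Type*}
    [MeasurableSpace Ω] {μ : Measure Ω} [Fintype ι] {X : T → Ω → ℝ}
    (hX : IsGaussianProcess X μ) (r : ι → T) (t : T) :
    ∃ w : ι → ℝ, HasGaussianLaw (fun ω => X t ω - ∑ j, w j * X (r j) ω) μ ∧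
      IndepFun (fun ω => X t ω - ∑ j, w j * X (r j) ω) (fun ω i => X (r i) ω) μ := by
  classical
  have := hX.isProbabilityMeasure
  have h2 : ∀ t, MemLp (X t) 2 μ := fun t => (hX.hasGaussianLaw_eval t).memLp_two
  obtain ⟨w, hw⟩ := exists_covariance_sub_sum_eq_zero (fun i => h2 (r i)) (h2 t)
  let Z : Unit → Ω → ℝ := fun _ ω => X t ω - ∑ j, w j * X (r j) ω
  have hjoint : IsGaussianProcess (Sum.elim Z fun i => X (r i)) μ := by
    refine hX.of_isGaussianProcess fun s => ?_
    rcases s with s | i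
    · let I : Finset T := insert t (Finset.univ.image r)
      refine ⟨I, ContinuousLinearMap.proj ⟨t, by simp [I]⟩ -
        ∑ j, w j • ContinuousLinearMap.proj ⟨r j, by simp [I]⟩, fun ω => ?_⟩
      simp [Z, Finset.restrict_def]
    · exact ⟨{r i}, ContinuousLinearMap.proj ⟨r i, by simp⟩, fun ω => by
        simp [Finset.restrict_def]⟩
  have hZ := hjoint.hasGaussianLaw_eval (.inl ())
  refine ⟨w, hZ, ?_⟩
  have := hjoint.indepFun_of_covariance_eq_zero (fun _ => hZ.aemeasurable)
    (fun i => hX.aemeasurable (r i)) fun _ i => hw i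
  exact this.comp (φ := fun z : Unit → ℝ => z ()) (ψ := id) (measurable_pi_apply _) measurable_id

/-- The mean conditional variance bounds the mean squared error of every predictor measurable with
respect to the conditioning σ-algebra. -/
lemma integral_condVar_le_variance_sub {Ω : Type*} {m m₀ : MeasurableSpace Ω} {μ : Measure Ω}
    [IsProbabilityMeasure μ] (hm : m ≤ m₀) {Y W : Ω → ℝ} (hY : MemLp Y 2 μ) (hW : MemLp W 2 μ)
    (hWm : StronglyMeasurable[m] W) :
    ∫ ω, (Var[Y; μ | m]) ω ∂μ ≤ Var[Y - W; μ] := by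
  have h : Var[Y - W; μ | m] =ᵐ[μ] Var[Y; μ | m] := by
    refine condExp_congr_ae ?_
    filter_upwards [condExp_sub (m := m) (hY.integrable one_le_two) (hW.integrable one_le_two)]
      with ω hω
    rw [condExp_of_stronglyMeasurable hm hWm (hW.integrable one_le_two)] at hω
    simp only [Pi.pow_apply, Pi.sub_apply] at hω ⊢
    rw [hω]
    ring
  rw [← integral_condVar_add_variance_condExp hm (hY.sub hW), integral_congr_ae h]
  linarith [variance_nonneg (μ[Y - W | m]) μ]

/-! ### Small-ball estimates -/

lemma gaussianReal_Icc_le (a x y : ℝ) {v : NNReal} (hv : v ≠ 0) :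
    gaussianReal a v (Set.Icc x y) ≤ ENNReal.ofReal ((y - x) / √(2 * Real.pi * v)) := by
  rw [gaussianReal_apply a hv]
  calc ∫⁻ z in Set.Icc x y, gaussianPDF a v z
      ≤ ∫⁻ _ in Set.Icc x y, ENNReal.ofReal (√(2 * Real.pi * v))⁻¹ := by
        refine lintegral_mono fun z => ENNReal.ofReal_le_ofReal ?_
        rw [gaussianPDFReal]
        refine mul_le_of_le_one_right (by positivity) (Real.exp_le_one_iff.2 ?_)
        exact div_nonpos_of_nonpos_of_nonneg (neg_nonpos.2 (sq_nonneg _)) (by positivity)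
    _ = _ := by
        rw [lintegral_const, Measure.restrict_apply_univ, Real.volume_Icc,
          ← ENNReal.ofReal_mul (by positivity)]
        congr 1
        ring

/-- If `Z` is independent of `V` and falls into any interval of radius `θ` with probability at most
`q`, then so does `Z` shifted by a function of `V`, even conditionally on `V`. -/
lemma ProbabilityTheory.IndepFun.measure_abs_add_le {Ω E : Type*} [MeasurableSpace Ω]
    [MeasurableSpace E] {μ : Measure Ω} [IsProbabilityMeasure μ] {Z : Ω → ℝ} {V : Ω → E}
    (h : IndepFun Z V μ) (hZ : Measurable Z) (hV : Measurable V) {θ : ℝ} {q : ℝ≥0∞}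
    (hq : ∀ x, μ.map Z (Set.Icc (x - θ) (x + θ)) ≤ q) {A : Set E} (hA : MeasurableSet A)
    {F : E → ℝ} (hF : Measurable F) :
    μ {ω | V ω ∈ A ∧ |Z ω + F (V ω)| ≤ θ} ≤ q * μ {ω | V ω ∈ A} := by
  have hprod := (indepFun_iff_map_prod_eq_prod_map_map hZ.aemeasurable hV.aemeasurable).1 h
  have := Measure.isProbabilityMeasure_map (μ := μ) hZ.aemeasurable
  have := Measure.isProbabilityMeasure_map (μ := μ) hV.aemeasurable
  let S : Set (ℝ × E) := {p | p.2 ∈ A ∧ |p.1 + F p.2| ≤ θ}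
  have hS : MeasurableSet S := (measurable_snd hA).inter
    (measurableSet_le ((measurable_fst.add (hF.comp measurable_snd)).abs) measurable_const)
  calc μ {ω | V ω ∈ A ∧ |Z ω + F (V ω)| ≤ θ}
      = ((μ.map Z).prod (μ.map V)) S := by
        rw [← hprod, Measure.map_apply (hZ.prodMk hV) hS]
        rfl
    _ = ∫⁻ v, μ.map Z ((fun z => (z, v)) ⁻¹' S) ∂(μ.map V) := Measure.prod_apply_symm hS
    _ ≤ ∫⁻ v, A.indicator (fun _ => q) v ∂(μ.map V) := by
        refine lintegral_mono fun v => ?_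
        by_cases hv : v ∈ A
        · rw [Set.indicator_of_mem hv]
          refine (measure_mono fun z hz => ?_).trans (hq (-F v))
          have := abs_le.1 hz.2
          constructor <;> linarith
        · simp [S, hv]
    _ = q * μ {ω | V ω ∈ A} := by
        rw [lintegral_indicator_const hA, Measure.map_apply hV hA]
        rfl

/-- The mean-square form of local nondeterminism: the error of linear prediction of `X t` from
finitely many values at times at most `t - d` has variance at least `c d ^ (2H)`. -/
lemma le_variance_sub_sum_of_slnd {Ω : Type*} [MeasurableSpace Ω] {μ : Measure Ω}
    [IsProbabilityMeasure μ] {T H c d : ℝ} {X : Set.Icc (0 : ℝ) T → Ω → ℝ}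
    (hmeas : ∀ t, Measurable (X t)) (hL2 : ∀ t, MemLp (X t) 2 μ) (hH : 0 ≤ H) (hc : 0 ≤ c)
    (hd : 0 ≤ d) {s t : Set.Icc (0 : ℝ) T} (hst : (s : ℝ) + d ≤ t)
    (hvar : ∀ᵐ ω ∂μ, c * |(t : ℝ) - s| ^ (2 * H) ≤ (Var[X t; μ | pastSigmaAlgebra X s]) ω)
    {ι : Type*} [Fintype ι] (r : ι → Set.Icc (0 : ℝ) T) (hr : ∀ i, r i ≤ s) (w : ι → ℝ) :
    c * d ^ (2 * H) ≤ Var[fun ω => X t ω - ∑ j, w j * X (r j) ω; μ] := by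
  have hm : pastSigmaAlgebra X s ≤ ‹MeasurableSpace Ω› :=
    iSup₂_le fun r _ => (hmeas r).comap_le
  have hW : StronglyMeasurable[pastSigmaAlgebra X s] fun ω => ∑ j, w j * X (r j) ω := by
    refine Finset.stronglyMeasurable_fun_sum _ fun j _ => ?_
    refine StronglyMeasurable.const_mul (Measurable.stronglyMeasurable ?_) _
    refine Measurable.mono (comap_measurable (X (r j))) ?_ le_rfl
    exact le_iSup₂_of_le (r j) (hr j) le_rfl
  calc c * d ^ (2 * H) ≤ c * |(t : ℝ) - s| ^ (2 * H) := by
        gcongr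
        rw [abs_of_nonneg] <;> linarith
    _ = ∫ _, c * |(t : ℝ) - s| ^ (2 * H) ∂μ := by simp
    _ ≤ ∫ ω, (Var[X t; μ | pastSigmaAlgebra X s]) ω ∂μ :=
        integral_mono_ae (integrable_const _) integrable_condVar hvar
    _ ≤ _ := integral_condVar_le_variance_sub hm (hL2 t)
        (memLp_finsetSum _ fun j _ => (hL2 (r j)).const_mul _) hW

/-- Small-ball estimate for moving averages of a strongly locally nondeterministic Gaussian process
along `d`-separated times. Each average has leading coefficient `1`, so, conditionally on the
earlier times, it is a shifted Gaussian variable of variance at least `c d ^ (2H)`; this costs one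
factor per average. -/
lemma measure_forall_abs_sum_le {Ω : Type*} [MeasurableSpace Ω] {μ : Measure Ω}
    [IsProbabilityMeasure μ] {T H c d θ : ℝ} {X : Set.Icc (0 : ℝ) T → Ω → ℝ}
    (hmeas : ∀ t, Measurable (X t)) (hX : IsGaussianProcess X μ) (hH : 0 ≤ H) (hc : 0 < c)
    (hd : 0 < d) (hθ : 0 ≤ θ)
    (hvar : ∀ s t : Set.Icc (0 : ℝ) T, s ≤ t →
      ∀ᵐ ω ∂μ, c * |(t : ℝ) - s| ^ (2 * H) ≤ (Var[X t; μ | pastSigmaAlgebra X s]) ω)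
    (t : ℕ → Set.Icc (0 : ℝ) T) (ht : Monotone t) (q : ℕ) (a : ℕ → ℝ) (ha : a (q + 1) = 1)
    (N : ℕ) (hsep : ∀ i < N + q, (t i : ℝ) + d ≤ t (i + 1)) :
    μ {ω | ∀ j < N, |∑ i ∈ Finset.range (q + 2), a i * X (t (j + i)) ω| ≤ θ} ≤
      ENNReal.ofReal (2 * θ / (√(2 * Real.pi * c) * d ^ H)) ^ N := by
  induction N with
  | zero => simp
  | succ N ih =>
    specialize ih fun i hi => hsep i (by omega)
    have hL2 : ∀ t, MemLp (X t) 2 μ := fun t => (hX.hasGaussianLaw_eval t).memLp_two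
    -- `V` records the times up to index `N + q`; the new variable sits at index `N + q + 1`.
    let V : Ω → Fin (N + q + 1) → ℝ := fun ω i => X (t i) ω
    have hV : Measurable V := measurable_pi_lambda _ fun i => hmeas _
    let e : ℕ → (Fin (N + q + 1) → ℝ) → ℝ := fun i v => if h : i < N + q + 1 then v ⟨i, h⟩ else 0
    have he : ∀ i, Measurable (e i) := fun i => by
      by_cases h : i < N + q + 1
      · simpa only [e, h, dif_pos] using measurable_pi_apply (⟨i, h⟩ : Fin (N + q + 1))
      · simp only [e, h, dif_neg, not_false_eq_true, measurable_const]
    have heV : ∀ i < N + q + 1, ∀ ω, e i (V ω) = X (t i) ω := fun i hi ω => by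
      simp only [e, hi, dif_pos, V]
    obtain ⟨w, hZG, hind⟩ :=
      hX.exists_indepFun_sub_sum (fun i : Fin (N + q + 1) => t i) (t (N + q + 1))
    set Z : Ω → ℝ := fun ω => X (t (N + q + 1)) ω - ∑ j : Fin (N + q + 1), w j * X (t j) ω with hZ
    have hZm : Measurable Z :=
      (hmeas _).sub (Finset.measurable_fun_sum _ fun j _ => (hmeas _).const_mul _)
    have hle : c * d ^ (2 * H) ≤ Var[Z; μ] :=
      le_variance_sub_sum_of_slnd hmeas hL2 hH hc.le hd.le (hsep (N + q) (by omega))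
        (hvar _ _ (ht (by omega))) _ (fun i => ht (by omega)) w
    have hcd : 0 < c * d ^ (2 * H) := by positivity
    have hball : ∀ x, μ.map Z (Set.Icc (x - θ) (x + θ)) ≤
        ENNReal.ofReal (2 * θ / (√(2 * Real.pi * c) * d ^ H)) := fun x => by
      rw [hZG.map_eq_gaussianReal]
      refine (gaussianReal_Icc_le _ _ _ ?_).trans (ENNReal.ofReal_le_ofReal ?_)
      · exact (Real.toNNReal_pos.2 (hcd.trans_le hle)).ne'
      · rw [show x + θ - (x - θ) = 2 * θ by ring, Real.coe_toNNReal _ (hcd.le.trans hle)]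
        have hsq : √(2 * Real.pi * c) * d ^ H = √(2 * Real.pi * (c * d ^ (2 * H))) := by
          rw [← mul_assoc, Real.sqrt_mul (by positivity) (d ^ _), mul_comm 2 H,
            Real.rpow_mul hd.le, Real.rpow_two, Real.sqrt_sq (by positivity)]
        rw [hsq]
        gcongr
    let A : Set (Fin (N + q + 1) → ℝ) :=
      {v | ∀ j < N, |∑ i ∈ Finset.range (q + 2), a i * e (j + i) v| ≤ θ}
    have hA : MeasurableSet A := by
      have : A = ⋂ j, ⋂ (_ : j < N), {v | |∑ i ∈ Finset.range (q + 2), a i * e (j + i) v| ≤ θ} := by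
        ext; simp [A]
      rw [this]
      refine MeasurableSet.iInter fun j => MeasurableSet.iInter fun _ =>
        measurableSet_le (Measurable.abs ?_) measurable_const
      exact Finset.measurable_fun_sum _ fun i _ => (he _).const_mul _
    let F : (Fin (N + q + 1) → ℝ) → ℝ := fun v =>
      ∑ j, w j * v j + ∑ i ∈ Finset.range (q + 1), a i * e (N + i) v
    have hF : Measurable F :=
      (Finset.measurable_fun_sum _ fun j _ => (measurable_pi_apply j).const_mul _).add
        (Finset.measurable_fun_sum _ fun i _ => (he _).const_mul _)
    have hAV : ∀ ω, V ω ∈ A ↔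
        ∀ j < N, |∑ i ∈ Finset.range (q + 2), a i * X (t (j + i)) ω| ≤ θ := fun ω => by
      refine forall₂_congr fun j hj => ?_
      rw [Finset.sum_congr rfl fun i hi => ?_]
      rw [Finset.mem_range] at hi
      rw [heV _ (by omega)]
    have hFV : ∀ ω, Z ω + F (V ω) = ∑ i ∈ Finset.range (q + 2), a i * X (t (N + i)) ω := fun ω => by
      have : ∑ i ∈ Finset.range (q + 1), a i * e (N + i) (V ω) =
          ∑ i ∈ Finset.range (q + 1), a i * X (t (N + i)) ω := Finset.sum_congr rfl fun i hi => by
        rw [heV (N + i) (by rw [Finset.mem_range] at hi; omega)]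
      simp only [hZ, F, this, V, Finset.sum_range_succ _ (q + 1), ha, one_mul, ← add_assoc]
      ring
    calc μ {ω | ∀ j < N + 1, |∑ i ∈ Finset.range (q + 2), a i * X (t (j + i)) ω| ≤ θ}
        = μ {ω | V ω ∈ A ∧ |Z ω + F (V ω)| ≤ θ} := by
          congr 1
          ext ω
          simp only [Set.mem_ofPred_eq, Nat.forall_lt_succ_right, hAV, hFV]
      _ ≤ _ * μ {ω | V ω ∈ A} := hind.measure_abs_add_le hZm hV hball hA hF
      _ ≤ _ := by
          simp only [hAV]
          rw [pow_succ']
          gcongr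

/-! ### Polynomial approximation and finite differences -/

/-- The signed binomial coefficients of the `n`-th forward difference. -/
def fwdDiffCoeff (n i : ℕ) : ℝ := (-1) ^ (n - i) * n.choose i

/-- The `n`-th difference annihilates polynomials of degree less than `n`, so it only sees the
distance of `f` to such a polynomial. -/
lemma abs_sum_fwdDiffCoeff_le {f : ℝ → ℝ} {P : Polynomial ℝ} {n : ℕ} (hP : P.natDegree < n)
    {y d τ : ℝ} (h : ∀ i ≤ n, |f (y + i * d) - P.eval (y + i * d)| ≤ τ) :
    |∑ i ∈ Finset.range (n + 1), fwdDiffCoeff n i * f (y + i * d)| ≤ 2 ^ n * τ := by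
  have hzero : ∑ i ∈ Finset.range (n + 1), fwdDiffCoeff n i * P.eval (y + i * d) = 0 := by
    let Q : Polynomial ℝ := P.comp (Polynomial.C d * Polynomial.X + Polynomial.C y)
    have hQ : Q.natDegree < n := by
      refine (Polynomial.natDegree_comp_le.trans ?_).trans_lt hP
      exact mul_le_of_le_one_right (Nat.zero_le _) Polynomial.natDegree_linear_le
    have h0 := congrFun (Polynomial.fwdDiff_iter_eq_zero_of_degree_lt hQ) 0
    rw [fwdDiff_iter_eq_sum_shift] at h0
    simp only [zero_add, nsmul_eq_mul, mul_one, Pi.zero_apply] at h0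
    rw [← h0]
    refine Finset.sum_congr rfl fun i _ => ?_
    simp only [fwdDiffCoeff, Q, Polynomial.eval_comp, Polynomial.eval_add, Polynomial.eval_mul,
      Polynomial.eval_C, Polynomial.eval_X, zsmul_eq_mul]
    push_cast
    rw [mul_comm d, add_comm y]
  calc |∑ i ∈ Finset.range (n + 1), fwdDiffCoeff n i * f (y + i * d)|
      = |∑ i ∈ Finset.range (n + 1),
          fwdDiffCoeff n i * (f (y + i * d) - P.eval (y + i * d))| := by
        simp only [mul_sub, Finset.sum_sub_distrib, hzero, sub_zero]
    _ ≤ ∑ i ∈ Finset.range (n + 1), (n.choose i : ℝ) * τ := by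
        refine (Finset.abs_sum_le_sum_abs _ _).trans (Finset.sum_le_sum fun i hi => ?_)
        rw [abs_mul]
        have : |fwdDiffCoeff n i| = n.choose i := by simp [fwdDiffCoeff, abs_mul]
        rw [this]
        gcongr
        exact h i (by rw [Finset.mem_range] at hi; omega)
    _ = 2 ^ n * τ := by
        rw [← Finset.sum_mul]
        congr 1
        exact_mod_cast Nat.sum_range_choose n

/-- Shifting a grid of `M` points by `u ∈ [0, d]` avoids a set `E` for all `u` outside a set of
measure at most `M` times that of `E`. -/
lemma ofReal_le_volume_shift_add (E : Set ℝ) (x d : ℝ) (M : ℕ) :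
    ENNReal.ofReal d ≤ volume {u ∈ Set.Icc 0 d | ∀ j < M, x + u + j * d ∉ E} + M * volume E := by
  have hbad : ∀ j : ℕ, volume {u | x + u + j * d ∈ E} = volume E := fun j => by
    rw [← measure_preimage_add volume (x + j * d) E]
    congr 1
    ext u
    simp only [Set.mem_ofPred_eq, Set.mem_preimage]
    rw [add_right_comm]
  calc ENNReal.ofReal d = volume (Set.Icc 0 d) := by simp
    _ ≤ volume ({u ∈ Set.Icc 0 d | ∀ j < M, x + u + j * d ∉ E} ∪
          ⋃ j ∈ Finset.range M, {u | x + u + j * d ∈ E}) := by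
        refine measure_mono fun u hu => ?_
        by_cases h : ∀ j < M, x + u + j * d ∉ E
        · exact .inl ⟨hu, h⟩
        · push Not at h
          obtain ⟨j, hj, hjE⟩ := h
          exact .inr (Set.mem_biUnion (Finset.mem_coe.2 (Finset.mem_range.2 hj)) hjE)
    _ ≤ _ := by
        refine (measure_union_le _ _).trans (add_le_add le_rfl ?_)
        refine (measure_biUnion_finset_le _ _).trans ?_
        simp [hbad]

/-- Markov's inequality for the index: a small index provides an interval and a polynomial for which
the exceptional set `{|f - P| > τ}` is small. -/
lemma exists_volume_lt_abs_sub_le {T α p δ : ℝ} {k : ℕ} (hp : 0 < p) (hδ : 0 < δ)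
    {f : Set.Icc (0 : ℝ) T → ℝ} (hf : Measurable f) {g : ℝ → ℝ}
    (hg : ∀ x : Set.Icc (0 : ℝ) T, g x = f x)
    (h : irregularityIndex α k p f < ENNReal.ofReal δ) :
    ∃ a b : ℝ, 0 ≤ a ∧ a < b ∧ b ≤ T ∧ b - a ≤ 1 ∧ ∃ P : Polynomial ℝ, P.natDegree ≤ k ∧
      ∀ τ, 0 < τ → volume {x ∈ Set.Icc a b | τ < |g x - P.eval x|} ≤
        ENNReal.ofReal ((b - a) * (δ * (b - a) ^ α / τ) ^ p) := by
  simp only [irregularityIndex, iInf_lt_iff] at h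
  obtain ⟨a, b, hab, hab1, P, hP, h⟩ := h
  refine ⟨a, b, a.2.1, hab, b.2.2, hab1, P, hP, fun τ hτ => ?_⟩
  have hl : 0 < (b : ℝ) - a := sub_pos.2 hab
  have hemb : MeasurableEmbedding (Subtype.val : Set.Icc (0 : ℝ) T → ℝ) :=
    MeasurableEmbedding.subtype_coe measurableSet_Icc
  have himage : ∀ S : Set (Set.Icc (0 : ℝ) T), lebesgueOn 0 T S = volume (Subtype.val '' S) :=
    fun S => hemb.comap_apply _ S
  have hIcc : lebesgueOn 0 T (Set.Icc a b) = ENNReal.ofReal (b - a) := by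
    rw [himage, ← Real.volume_Icc]
    congr 1
    ext x
    constructor
    · rintro ⟨y, hy, rfl⟩
      exact hy
    · exact fun hx => ⟨⟨x, a.2.1.trans hx.1, hx.2.trans b.2.2⟩, hx, rfl⟩
  set A := ⨍⁻ x in Set.Icc a b, ‖f x - P.eval (x : ℝ)‖ₑ ^ p ∂(lebesgueOn 0 T) with hA
  have hA_le : A ≤ ENNReal.ofReal ((δ * ((b : ℝ) - a) ^ α) ^ p) := by
    have h1 : A ^ (1 / p) ≤ ENNReal.ofReal (δ * ((b : ℝ) - a) ^ α) := by
      calc A ^ (1 / p)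
          = ENNReal.ofReal (((b : ℝ) - a) ^ α) *
              (ENNReal.ofReal (((b : ℝ) - a) ^ (-α)) * A ^ (1 / p)) := by
            rw [← mul_assoc, ← ENNReal.ofReal_mul (by positivity), ← Real.rpow_add hl]
            simp
        _ ≤ ENNReal.ofReal (((b : ℝ) - a) ^ α) * ENNReal.ofReal δ := by gcongr
        _ = _ := by rw [← ENNReal.ofReal_mul (by positivity), mul_comm]
    calc A = (A ^ (1 / p)) ^ p := by
          rw [← ENNReal.rpow_mul, one_div_mul_cancel hp.ne', ENNReal.rpow_one]
      _ ≤ _ := by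
          rw [← ENNReal.ofReal_rpow_of_nonneg (by positivity) hp.le]
          gcongr
  have hmark := mul_meas_ge_le_lintegral₀ (μ := (lebesgueOn 0 T).restrict (Set.Icc a b))
    (f := fun x => ‖f x - P.eval (x : ℝ)‖ₑ ^ p)
    ((hf.sub (P.continuous.measurable.comp measurable_subtype_coe)).enorm.pow_const
      p).aemeasurable (ENNReal.ofReal (τ ^ p))
  have hint : ∫⁻ x in Set.Icc a b, ‖f x - P.eval (x : ℝ)‖ₑ ^ p ∂(lebesgueOn 0 T) =
      A * ENNReal.ofReal (b - a) := by
    rw [hA, setLAverage_eq, hIcc, ENNReal.div_mul_cancel] <;> simp [Subtype.coe_lt_coe.1 hab]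
  have hset : volume {x ∈ Set.Icc (a : ℝ) b | τ < |g x - P.eval x|} ≤
      (lebesgueOn 0 T).restrict (Set.Icc a b)
        {x | ENNReal.ofReal (τ ^ p) ≤ ‖f x - P.eval (x : ℝ)‖ₑ ^ p} := by
    rw [Measure.restrict_apply' measurableSet_Icc, himage]
    refine measure_mono fun x hx => ?_
    refine ⟨⟨x, a.2.1.trans hx.1.1, hx.1.2.trans b.2.2⟩, ⟨?_, hx.1⟩, rfl⟩
    have h2 := hx.2
    have h3 := hg ⟨x, a.2.1.trans hx.1.1, hx.1.2.trans b.2.2⟩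
    rw [Set.mem_ofPred_eq, ← ENNReal.ofReal_rpow_of_nonneg hτ.le hp.le, ← h3,
      Real.enorm_eq_ofReal_abs]
    gcongr
  have hτp : 0 < τ ^ p := by positivity
  calc volume {x ∈ Set.Icc (a : ℝ) b | τ < |g x - P.eval x|}
      ≤ A * ENNReal.ofReal (b - a) / ENNReal.ofReal (τ ^ p) := by
        refine hset.trans ?_
        rw [ENNReal.le_div_iff_mul_le (.inl (by simpa using hτp)) (.inl ENNReal.ofReal_ne_top),
          ← hint, mul_comm]
        exact hmark
    _ ≤ ENNReal.ofReal ((δ * ((b : ℝ) - a) ^ α) ^ p) * ENNReal.ofReal (b - a) /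
          ENNReal.ofReal (τ ^ p) := by gcongr
    _ = _ := by
        rw [← ENNReal.ofReal_mul (by positivity), ← ENNReal.ofReal_div_of_pos hτp,
          Real.div_rpow (by positivity) hτ.le]
        congr 1
        ring

/-- Discretization: a small index forces, on some dyadic interval, small `(k + 1)`-st differences
along a grid of step `d`, for at least half of the shifts of the grid by `u ∈ [0, d]`. -/
lemma exists_dyadic_ofReal_le_volume {T α p δ : ℝ} {k : ℕ} (hT : T ≤ 4) (hα : 0 ≤ α) (hp : 1 ≤ p)
    (hδ : 0 < δ) {f : Set.Icc (0 : ℝ) T → ℝ} (hf : Measurable f) {g : ℝ → ℝ}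
    (hg : ∀ x : Set.Icc (0 : ℝ) T, g x = f x)
    (h : irregularityIndex α k p f < ENNReal.ofReal δ) (N : ℕ) :
    ∃ n i : ℕ, i < 2 ^ (n + 4) ∧ (i + 1) * (1 / 2 : ℝ) ^ (n + 2) ≤ T ∧
      ENNReal.ofReal ((1 / 2 : ℝ) ^ (n + 2) / (N + k + 1) / 2) ≤
        volume {u ∈ Set.Icc 0 ((1 / 2 : ℝ) ^ (n + 2) / (N + k + 1)) | ∀ j < N,
          |∑ l ∈ Finset.range (k + 2), fwdDiffCoeff (k + 1) l *
            g (i * (1 / 2 : ℝ) ^ (n + 2) + u +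
              (j + l : ℕ) * ((1 / 2 : ℝ) ^ (n + 2) / (N + k + 1)))| ≤
          2 ^ (k + 1) * (8 * (N + k + 1) ^ 2 * 4 ^ α) * δ * ((1 / 2 : ℝ) ^ (n + 2)) ^ α} := by
  obtain ⟨a, b, ha, hab, hb, hab1, P, hP, hvol⟩ :=
    exists_volume_lt_abs_sub_le (by linarith) hδ hf hg h
  have hl : 0 < b - a := sub_pos.2 hab
  obtain ⟨n, hn1, hn2⟩ := exists_nat_pow_near_of_lt_one hl hab1 (y := (1 / 2 : ℝ))
    (by norm_num) (by norm_num)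
  set η : ℝ := (1 / 2 : ℝ) ^ (n + 2) with hη
  have hη0 : 0 < η := by positivity
  have h1 : 2 * η < b - a := by
    rw [hη, pow_succ]; linarith
  have h2 : b - a ≤ 4 * η := by
    rw [hη, pow_add]; linarith
  -- The first dyadic point of mesh `η` to the right of `a` starts an interval inside `[a, b]`.
  let i := ⌈a / η⌉₊
  have hi1 : a ≤ i * η := (div_le_iff₀ hη0).1 (Nat.le_ceil _)
  have hi2 : (i + 1) * η ≤ b := by
    have := (lt_div_iff₀ hη0).1 (sub_lt_iff_lt_add.2 (Nat.ceil_lt_add_one (div_nonneg ha hη0.le)))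
    have : ((i : ℝ) - 1) * η < a := this
    linarith
  set M : ℕ := N + k + 1 with hM
  have hMc : (N : ℝ) + k + 1 = M := by simp [hM]
  have hM0 : (1 : ℝ) ≤ M := by rw [hM]; simp; positivity
  rw [hMc]
  set d : ℝ := η / M with hd
  have hMd : M * d = η := by rw [hd]; field_simp
  have hd0 : 0 < d := by positivity
  have hi3 : (i : ℝ) * η + η ≤ b := by linarith
  refine ⟨n, i, ?_, by linarith, ?_⟩
  · have h3 : (i : ℝ) * η < 4 := by linarith
    have h4 : (2 : ℝ) ^ (n + 4) * η = 4 := by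
      rw [hη, show n + 4 = (n + 2) + 2 by ring, pow_add 2, mul_right_comm, ← mul_pow]
      norm_num
    have : (i : ℝ) < (2 : ℝ) ^ (n + 4) := lt_of_mul_lt_mul_right (by linarith) hη0.le
    exact_mod_cast this
  set τ : ℝ := 8 * M ^ 2 * δ * (b - a) ^ α with hτ
  have hla : 0 < (b - a) ^ α := by positivity
  have hτ0 : 0 < τ := by positivity
  set E : Set ℝ := {x ∈ Set.Icc a b | τ < |g x - P.eval x|} with hE
  -- The factor `8 M ^ 2` in `τ` makes the exceptional shifts at most half of `[0, d]`.
  have hEvol : M * volume E ≤ ENNReal.ofReal (d / 2) := by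
    have hratio : δ * (b - a) ^ α / τ = 1 / (8 * M ^ 2) := by
      rw [hτ]; field_simp
    have hpow : (1 / (8 * (M : ℝ) ^ 2)) ^ p ≤ 1 / (8 * M ^ 2) := by
      refine Real.rpow_le_self_of_le_one (by positivity) ?_ hp
      rw [div_le_one (by positivity)]
      nlinarith
    calc M * volume E ≤ M * ENNReal.ofReal ((b - a) * (1 / (8 * (M : ℝ) ^ 2)) ^ p) := by
          rw [← hratio]
          gcongr
          exact hvol τ hτ0
      _ ≤ ENNReal.ofReal M * ENNReal.ofReal (4 * η * (1 / (8 * M ^ 2))) := by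
          rw [ENNReal.ofReal_natCast]
          gcongr
      _ = ENNReal.ofReal (d / 2) := by
          rw [← ENNReal.ofReal_mul (by positivity), hd]
          congr 1
          field_simp
          norm_num
  have hhalf : ENNReal.ofReal (d / 2) ≤
      volume {u ∈ Set.Icc 0 d | ∀ j < M, i * η + u + j * d ∉ E} := by
    have := (ofReal_le_volume_shift_add E (i * η) d M).trans (add_le_add le_rfl hEvol)
    rw [show ENNReal.ofReal d = ENNReal.ofReal (d / 2) + ENNReal.ofReal (d / 2) by
      rw [← ENNReal.ofReal_add (by positivity) (by positivity), add_halves]] at this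
    exact (ENNReal.add_le_add_iff_right ENNReal.ofReal_ne_top).1 this
  refine hhalf.trans (measure_mono fun u hu => ⟨hu.1, fun j hj => ?_⟩)
  have hgrid : ∀ j < M, |g (i * η + u + j * d) - P.eval (i * η + u + j * d)| ≤ τ := fun j hj => by
    by_contra hcon
    refine hu.2 j hj ⟨⟨?_, ?_⟩, not_le.1 hcon⟩
    · have := hu.1.1
      have : 0 ≤ j * d := by positivity
      linarith
    · have hj1 : (j : ℝ) + 1 ≤ M := by exact_mod_cast hj
      have := hu.1.2
      nlinarith
  have hdiff := abs_sum_fwdDiffCoeff_le (f := g) (y := i * η + u + j * d) (d := d) (τ := τ)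
    (Nat.lt_succ_of_le hP) fun l hl => by
      have := hgrid (j + l) (by omega)
      rw [Nat.cast_add, add_mul, ← add_assoc] at this
      exact this
  calc _ = |∑ l ∈ Finset.range (k + 1 + 1), fwdDiffCoeff (k + 1) l *
          g (i * η + u + j * d + l * d)| := by
        simp only [Nat.cast_add, add_mul, add_assoc]
        rfl
    _ ≤ 2 ^ (k + 1) * τ := hdiff
    _ ≤ _ := by
        have : (b - a) ^ α ≤ 4 ^ α * η ^ α := by
          rw [← Real.mul_rpow (by norm_num) hη0.le]
          gcongr
        calc 2 ^ (k + 1) * τ ≤ 2 ^ (k + 1) * (8 * M ^ 2 * δ * (4 ^ α * η ^ α)) := by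
              rw [hτ]; gcongr
          _ = _ := by ring

/-! ### Probability of a small index -/

/-- The small-ball estimate for differences along a grid, averaged over the shifts of the grid. By
averaging, it holds for any jointly measurable `Y` that agrees with the process at almost every
time. -/
lemma measure_ofReal_le_volume_le {Ω : Type*} [MeasurableSpace Ω] {μ : Measure Ω}
    [IsProbabilityMeasure μ] {T H c d θ x : ℝ} (hT : 0 ≤ T) {X : Set.Icc (0 : ℝ) T → Ω → ℝ}
    (hmeas : ∀ t, Measurable (X t)) (hX : IsGaussianProcess X μ) (hH : 0 ≤ H) (hc : 0 < c)
    (hd : 0 < d) (hθ : 0 ≤ θ)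
    (hvar : ∀ s t : Set.Icc (0 : ℝ) T, s ≤ t →
      ∀ᵐ ω ∂μ, c * |(t : ℝ) - s| ^ (2 * H) ≤ (Var[X t; μ | pastSigmaAlgebra X s]) ω)
    {Y : ℝ → Ω → ℝ} (hY : Measurable (Function.uncurry Y))
    (hXY : ∀ᵐ t : ℝ, t ∈ Set.Icc (0 : ℝ) T → Y t =ᵐ[μ] X (Set.projIcc 0 T hT t))
    (k N : ℕ) (hx : 0 ≤ x) (hxT : x + (N + k + 1) * d ≤ T) :
    μ {ω | ENNReal.ofReal (d / 2) ≤ volume {u ∈ Set.Icc 0 d | ∀ j < N,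
        |∑ l ∈ Finset.range (k + 2), fwdDiffCoeff (k + 1) l *
          Y (x + u + (j + l : ℕ) * d) ω| ≤ θ}} ≤
      2 * ENNReal.ofReal (2 * θ / (√(2 * Real.pi * c) * d ^ H)) ^ N := by
  let G : Set (ℝ × Ω) := {z | ∀ j < N, |∑ l ∈ Finset.range (k + 2), fwdDiffCoeff (k + 1) l *
    Y (x + z.1 + (j + l : ℕ) * d) z.2| ≤ θ}
  have hG : MeasurableSet G := by
    have : G = ⋂ j, ⋂ (_ : j < N), {z | |∑ l ∈ Finset.range (k + 2), fwdDiffCoeff (k + 1) l *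
        Y (x + z.1 + (j + l : ℕ) * d) z.2| ≤ θ} := by
      ext; simp [G]
    rw [this]
    refine MeasurableSet.iInter fun j => MeasurableSet.iInter fun _ =>
      measurableSet_le (Measurable.abs ?_) measurable_const
    refine Finset.measurable_fun_sum _ fun l _ => Measurable.const_mul ?_ _
    exact hY.comp (f := fun z : ℝ × Ω => (x + z.1 + (j + l : ℕ) * d, z.2))
      (by fun_prop)
  set q := ENNReal.ofReal (2 * θ / (√(2 * Real.pi * c) * d ^ H)) with hq
  have hgood : ∀ᵐ u : ℝ, ∀ i : ℕ, x + u + i * d ∈ Set.Icc 0 T →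
      Y (x + u + i * d) =ᵐ[μ] X (Set.projIcc 0 T hT (x + u + i * d)) := by
    refine ae_all_iff.2 fun i => ?_
    have := (measurePreserving_add_left volume (x + i * d)).quasiMeasurePreserving.ae hXY
    filter_upwards [this] with u hu
    rwa [add_right_comm] at hu
  have hsection : ∀ᵐ u ∂volume.restrict (Set.Icc 0 d), μ (Prod.mk u ⁻¹' G) ≤ q ^ N := by
    filter_upwards [ae_restrict_of_ae hgood, ae_restrict_mem measurableSet_Icc] with u hu hud
    let t : ℕ → Set.Icc (0 : ℝ) T := fun i => Set.projIcc 0 T hT (x + u + i * d)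
    have ht : Monotone t := fun i j hij => Set.monotone_projIcc hT (by gcongr)
    have hmem : ∀ i ≤ N + k, x + u + i * d ∈ Set.Icc 0 T := fun i hi => by
      have hi' : (i : ℝ) ≤ N + k := by exact_mod_cast hi
      have h0 := hud.1
      have h1 := hud.2
      constructor
      · positivity
      · nlinarith
    have hsep : ∀ i < N + k, (t i : ℝ) + d ≤ t (i + 1) := fun i hi => by
      have h1 := Set.projIcc_of_mem hT (hmem i (by omega))
      have h2 := Set.projIcc_of_mem hT (hmem (i + 1) (by omega))
      simp only [t, h1, h2]
      push_cast
      linarith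
    have hball := measure_forall_abs_sum_le hmeas hX hH hc hd hθ hvar t ht k
      (fwdDiffCoeff (k + 1)) (by simp [fwdDiffCoeff]) N hsep
    refine le_trans (le_of_eq (measure_congr ?_)) hball
    have hall : ∀ᵐ ω ∂μ, ∀ i ≤ N + k, Y (x + u + i * d) ω = X (t i) ω :=
      ae_all_iff.2 fun i => by
        by_cases hi : i ≤ N + k
        · filter_upwards [hu i (hmem i hi)] with ω hω _ using hω
        · exact ae_of_all _ fun _ h => absurd h hi
    filter_upwards [hall] with ω hω
    refine propext (forall₂_congr fun j hj => ?_)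
    rw [Finset.sum_congr rfl fun l hl => ?_]
    rw [Finset.mem_range] at hl
    rw [hω _ (by omega)]
  have hfubini : ∫⁻ ω, volume {u ∈ Set.Icc 0 d | (u, ω) ∈ G} ∂μ ≤ q ^ N * ENNReal.ofReal d := by
    calc ∫⁻ ω, volume {u ∈ Set.Icc 0 d | (u, ω) ∈ G} ∂μ
        = ((volume.restrict (Set.Icc 0 d)).prod μ) G := by
          rw [Measure.prod_apply_symm hG]
          refine lintegral_congr fun ω => ?_
          rw [Measure.restrict_apply (measurable_prodMk_right hG), Set.inter_comm]
          rfl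
      _ = ∫⁻ u in Set.Icc 0 d, μ (Prod.mk u ⁻¹' G) := Measure.prod_apply hG
      _ ≤ ∫⁻ _ in Set.Icc 0 d, q ^ N := lintegral_mono_ae hsection
      _ = q ^ N * ENNReal.ofReal d := by simp
  have hvolm : Measurable fun ω => volume {u ∈ Set.Icc 0 d | (u, ω) ∈ G} := by
    have := measurable_measure_prodMk_right (μ := volume.restrict (Set.Icc (0 : ℝ) d)) hG
    convert! this using 2 with ω
    rw [Measure.restrict_apply (measurable_prodMk_right hG), Set.inter_comm]
    rfl
  have hmark := (mul_meas_ge_le_lintegral hvolm (ENNReal.ofReal (d / 2))).trans hfubini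
  have hd2 : ENNReal.ofReal d = ENNReal.ofReal (d / 2) * 2 := by
    rw [← ENNReal.ofReal_ofNat 2, ← ENNReal.ofReal_mul (by positivity)]
    congr 1
    ring
  rw [hd2, mul_left_comm] at hmark
  rw [mul_comm 2]
  exact (ENNReal.mul_le_mul_iff_right (by simpa using hd) ENNReal.ofReal_ne_top).1 hmark

/-- If `X` has a jointly measurable version `Y`, then its index falls below `δ` with probability
`O(δ)`: sum the grid estimate over all dyadic intervals. -/
lemma exists_measure_irregularityIndex_lt_le {Ω : Type*} [MeasurableSpace Ω] {μ : Measure Ω}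
    [IsProbabilityMeasure μ] {T H α p : ℝ} (hT : 0 ≤ T) (hT4 : T ≤ 4)
    {X : Set.Icc (0 : ℝ) T → Ω → ℝ} (hmeas : ∀ t, Measurable (X t)) (hX : IsGaussianProcess X μ)
    (hH : 0 ≤ H) (hSLND : IsStronglyLocallyNondeterministic X H μ) (hα : H < α) (hp : 1 ≤ p)
    {Y : Set.Icc (0 : ℝ) T → Ω → ℝ} (hY : Measurable (Function.uncurry Y))
    (hXY : ∀ᵐ t ∂lebesgueOn 0 T, Y t =ᵐ[μ] X t) (k : ℕ) :
    ∃ K : ℝ, ∀ δ : ℝ, 0 < δ → δ ≤ 1 →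
      μ {ω | irregularityIndex α k p (fun t => Y t ω) < ENNReal.ofReal δ} ≤
        ENNReal.ofReal (K * δ) := by
  obtain ⟨c, hc, hvar⟩ := hSLND
  -- With `N` factors the union bound over the `2 ^ (n + 4)` intervals of level `n` is summable.
  obtain ⟨N, hN⟩ := exists_nat_gt (2 / (α - H))
  have hαH : 0 < α - H := sub_pos.2 hα
  have hN2 : 2 ≤ (α - H) * N := by
    rw [div_lt_iff₀ hαH] at hN
    linarith
  have hN1 : N ≠ 0 := by
    rintro rfl
    norm_num at hN2
  set M : ℝ := N + k + 1 with hM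
  have hM0 : 0 < M := by positivity
  set K₁ : ℝ := 2 ^ (k + 1) * (8 * M ^ 2 * 4 ^ α) with hK₁
  set K₂ : ℝ := 2 * K₁ * M ^ H / √(2 * Real.pi * c) with hK₂
  have hK₁0 : 0 < K₁ := by positivity
  have hK₂0 : 0 < K₂ := by positivity
  refine ⟨4 * K₂ ^ N, fun δ hδ hδ1 => ?_⟩
  let Y' : ℝ → Ω → ℝ := fun t => Y (Set.projIcc 0 T hT t)
  have hY' : Measurable (Function.uncurry Y') := by
    exact hY.comp (f := fun z : ℝ × Ω => (Set.projIcc 0 T hT z.1, z.2))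
      ((continuous_projIcc.measurable.comp measurable_fst).prodMk measurable_snd)
  have hXY' : ∀ᵐ t : ℝ, t ∈ Set.Icc (0 : ℝ) T → Y' t =ᵐ[μ] X (Set.projIcc 0 T hT t) := by
    rw [← ae_restrict_iff' measurableSet_Icc]
    have hemb : MeasurableEmbedding (Subtype.val : Set.Icc (0 : ℝ) T → ℝ) :=
      MeasurableEmbedding.subtype_coe measurableSet_Icc
    rw [← map_comap_subtype_coe measurableSet_Icc, hemb.ae_map_iff]
    filter_upwards [hXY] with t ht
    simpa [Y'] using ht
  let B : ℕ → ℕ → Set Ω := fun n i =>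
    {ω | (i + 1) * (1 / 2 : ℝ) ^ (n + 2) ≤ T ∧
      ENNReal.ofReal ((1 / 2 : ℝ) ^ (n + 2) / M / 2) ≤
        volume {u ∈ Set.Icc 0 ((1 / 2 : ℝ) ^ (n + 2) / M) | ∀ j < N,
          |∑ l ∈ Finset.range (k + 2), fwdDiffCoeff (k + 1) l *
            Y' (i * (1 / 2 : ℝ) ^ (n + 2) + u + (j + l : ℕ) * ((1 / 2 : ℝ) ^ (n + 2) / M)) ω| ≤
          K₁ * δ * ((1 / 2 : ℝ) ^ (n + 2)) ^ α}}
  have hB : ∀ n i, μ (B n i) ≤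
      ENNReal.ofReal (2 * (K₂ ^ N * δ * ((1 / 2 : ℝ) ^ (n + 2)) ^ 2)) := fun n i => by
    set η : ℝ := (1 / 2 : ℝ) ^ (n + 2) with hη
    have hη0 : 0 < η := by positivity
    have hη1 : η ≤ 1 := pow_le_one₀ (by norm_num) (by norm_num)
    by_cases hi : (i + 1) * η ≤ T
    swap
    · rw [show B n i = ∅ from Set.eq_empty_of_forall_notMem fun ω hω => hi hω.1]
      simp
    have h1 := measure_ofReal_le_volume_le hT hmeas hX hH hc (d := η / M) (by positivity)
      (θ := K₁ * δ * η ^ α) (by positivity) hvar hY' hXY' k N (x := i * η) (by positivity)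
      (by rw [← hM, mul_div_cancel₀ _ hM0.ne']; linarith)
    have hbase : 2 * (K₁ * δ * η ^ α) / (√(2 * Real.pi * c) * (η / M) ^ H) =
        K₂ * δ * η ^ (α - H) := by
      rw [Real.div_rpow hη0.le hM0.le, Real.rpow_sub hη0, hK₂]
      field_simp
    rw [hbase] at h1
    refine (measure_mono fun ω hω => hω.2).trans (h1.trans ?_)
    rw [← ENNReal.ofReal_pow (by positivity), ← ENNReal.ofReal_ofNat 2,
      ← ENNReal.ofReal_mul (by norm_num)]
    refine ENNReal.ofReal_le_ofReal ?_
    rw [mul_pow, mul_pow]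
    have hδN : δ ^ N ≤ δ := pow_le_of_le_one hδ.le hδ1 hN1
    have hηN : (η ^ (α - H)) ^ N ≤ η ^ 2 := by
      rw [← Real.rpow_natCast, ← Real.rpow_mul hη0.le, ← Real.rpow_two]
      exact Real.rpow_le_rpow_of_exponent_ge hη0 hη1 hN2
    gcongr
  have hsub : {ω | irregularityIndex α k p (fun t => Y t ω) < ENNReal.ofReal δ} ⊆
      ⋃ n, ⋃ i ∈ Finset.range (2 ^ (n + 4)), B n i := fun ω hω => by
    obtain ⟨n, i, hi, hiT, hvol⟩ := exists_dyadic_ofReal_le_volume hT4 (by linarith) hp hδ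
      (f := fun t => Y t ω) (hY.comp measurable_prodMk_right) (g := fun t => Y' t ω)
      (fun t => by simp [Y']) hω N
    exact Set.mem_iUnion.2 ⟨n, Set.mem_biUnion (Finset.mem_coe.2 (Finset.mem_range.2 hi))
      ⟨hiT, hvol⟩⟩
  have hlevel : ∀ n, μ (⋃ i ∈ Finset.range (2 ^ (n + 4)), B n i) ≤
      ENNReal.ofReal (2 * (K₂ ^ N * δ) * (1 / 2) ^ n) := fun n => by
    calc μ (⋃ i ∈ Finset.range (2 ^ (n + 4)), B n i)
        ≤ ∑ i ∈ Finset.range (2 ^ (n + 4)), μ (B n i) := measure_biUnion_finset_le _ _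
      _ ≤ ∑ _i ∈ Finset.range (2 ^ (n + 4)),
          ENNReal.ofReal (2 * (K₂ ^ N * δ * ((1 / 2 : ℝ) ^ (n + 2)) ^ 2)) :=
          Finset.sum_le_sum fun i _ => hB n i
      _ = _ := by
          rw [Finset.sum_const, Finset.card_range, nsmul_eq_mul, ← ENNReal.ofReal_natCast,
            ← ENNReal.ofReal_mul (by positivity)]
          congr 1
          have : (2 : ℝ) ^ n * (1 / 2) ^ n = 1 := by rw [← mul_pow]; norm_num
          push_cast
          linear_combination (2 * (K₂ ^ N * δ) * (1 / 2) ^ n) * this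
  calc μ {ω | irregularityIndex α k p (fun t => Y t ω) < ENNReal.ofReal δ}
      ≤ ∑' n, μ (⋃ i ∈ Finset.range (2 ^ (n + 4)), B n i) :=
        (measure_mono hsub).trans (measure_iUnion_le _)
    _ ≤ ∑' n : ℕ, ENNReal.ofReal (2 * (K₂ ^ N * δ) * (1 / 2) ^ n) := ENNReal.tsum_le_tsum hlevel
    _ = ENNReal.ofReal (4 * K₂ ^ N * δ) := by
        rw [← ENNReal.ofReal_tsum_of_nonneg (fun n => by positivity)
          (summable_geometric_two.mul_left _), tsum_mul_left, tsum_geometric_two]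
        congr 1
        ring

lemma irregularityIndex_congr_ae {l r α p : ℝ} {k : ℕ} {f g : Set.Icc l r → ℝ}
    (h : f =ᵐ[lebesgueOn l r] g) : irregularityIndex α k p f = irregularityIndex α k p g := by
  have : ∀ (a b : Set.Icc l r) (P : Polynomial ℝ),
      ⨍⁻ x in Set.Icc a b, ‖f x - P.eval (x : ℝ)‖ₑ ^ p ∂(lebesgueOn l r) =
        ⨍⁻ x in Set.Icc a b, ‖g x - P.eval (x : ℝ)‖ₑ ^ p ∂(lebesgueOn l r) := fun a b P => by
    rw [setLAverage_eq, setLAverage_eq]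
    congr 1
    refine lintegral_congr_ae ?_
    filter_upwards [ae_restrict_of_ae h] with x hx
    rw [hx]
  simp only [irregularityIndex, this]

theorem theorem5p4 {Ω : Type*} [MeasurableSpace Ω] (μ : Measure Ω) [IsProbabilityMeasure μ]
    (X : Set.Icc (0 : ℝ) Real.pi → Ω → ℝ)
    (hmeas : ∀ t, Measurable (X t))
    (hjoint : AEMeasurable (Function.uncurry X) ((lebesgueOn 0 Real.pi).prod μ))
    (hGauss : IsGaussianProcess X μ)
    (H : ℝ) (hH : 1 < H)
    (hSLND : IsStronglyLocallyNondeterministic X H μ)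
    (α : ℝ) (hα : H < α) (p : ℝ) (hp : 1 ≤ p) (k : ℕ) (hk : 1 ≤ k) :
    ∀ᵐ ω ∂μ, 0 < irregularityIndex α k p (fun t => X t ω) := by
  have hfin : IsFiniteMeasure (lebesgueOn 0 Real.pi) := ⟨by
    rw [(MeasurableEmbedding.subtype_coe measurableSet_Icc).comap_apply, Set.image_univ,
      Subtype.range_coe]
    exact measure_Icc_lt_top⟩
  let Y : Set.Icc (0 : ℝ) Real.pi → Ω → ℝ := fun t ω => hjoint.mk _ (t, ω)
  have hY : Measurable (Function.uncurry Y) := hjoint.measurable_mk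
  have hXY : ∀ᵐ t ∂lebesgueOn 0 Real.pi, Y t =ᵐ[μ] X t := by
    filter_upwards [Measure.ae_ae_of_ae_prod hjoint.ae_eq_mk] with t ht
    filter_upwards [ht] with ω hω using hω.symm
  have hXY' : ∀ᵐ ω ∂μ, (fun t => X t ω) =ᵐ[lebesgueOn 0 Real.pi] fun t => Y t ω := by
    have := (Measure.measurePreserving_swap (μ := μ)
      (ν := lebesgueOn 0 Real.pi)).quasiMeasurePreserving.ae hjoint.ae_eq_mk
    exact Measure.ae_ae_of_ae_prod this
  obtain ⟨K, hK⟩ := exists_measure_irregularityIndex_lt_le Real.pi_pos.le Real.pi_le_four hmeas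
    hGauss (by linarith) hSLND hα hp hY hXY k
  have hzero : μ {ω | irregularityIndex α k p (fun t => Y t ω) = 0} = 0 := by
    have hlim : Filter.Tendsto (fun δ : ℝ => ENNReal.ofReal (K * δ)) (nhdsWithin 0 (Set.Ioi 0))
        (nhds 0) := by
      have : Continuous fun δ : ℝ => ENNReal.ofReal (K * δ) :=
        ENNReal.continuous_ofReal.comp (continuous_const_mul K)
      simpa using (this.tendsto 0).mono_left nhdsWithin_le_nhds
    refine le_antisymm (ge_of_tendsto hlim ?_) zero_le
    filter_upwards [Ioc_mem_nhdsGT one_pos] with δ hδ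
    refine (measure_mono fun ω hω => ?_).trans (hK δ hδ.1 hδ.2)
    rw [Set.mem_ofPred_eq] at hω ⊢
    rw [hω]
    exact ENNReal.ofReal_pos.2 hδ.1
  have hpos : ∀ᵐ ω ∂μ, irregularityIndex α k p (fun t => Y t ω) ≠ 0 := by
    rw [ae_iff]
    simpa using hzero
  filter_upwards [hXY', hpos] with ω h1 h2
  rw [irregularityIndex_congr_ae h1]
  exact pos_iff_ne_zero.2 h2
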